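/- Let $\mathcal H$ be a complex Hilbert space, let $\mathcal B(\mathcal H)$ be the $C^*$-algebra of bounded linear operators on $\mathcal H$ with identity $\mathbf 1$, and write $X\le Y$ if $X,Y$ are self-adjoint and $Y-X$ is positive. For positive invertible $A,B\in\mathcal B(\mathcal H)$ and real $p\neq 0$, the Tsallis relative operator entropy is \[ T_p(A|B)=\frac{A\natural_p B-A}{p},\qquad A\natural_p B=A^{1/2}\bigl(A^{-1/2}BA^{-1/2}\bigr)^pA^{1/2}. \] Let $A,B\in\mathcal B(\mathcal H)$ be positive with $A$ invertible, and let $m,M$ be real numbers with $m>0$ and \[ m\mathbf 1\le \mathbf 1\le A^{-1/2}BA^{-1/2}\le M\mathbf 1 . \] (Then $B$ is invertible as well.) Let $\Phi:\mathcal B(\mathcal H)\to\mathcal B(\mathcal H)$ be a unital positive linear map. Then: (1) for every real $p$ with $-1\le p\le 1$ and $p\neq 0$, \[ T_p(\Phi(A)|\Phi(B))\le \Phi(T_p(A|B))+\left(m^{p-1}-M^{p-1}\right)\Phi(B-A); \] (2) for every real $p$ with $1\le p\le 2$, \[ \Phi(T_p(A|B))\le T_p(\Phi(A)|\Phi(B))+\left(M^{p-1}-m^{p-1}\right)\Phi(B-A).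 \] -/

import Mathlib

/-- `A ♮_p B = A^(1/2) (A^(-1/2) B A^(-1/2))^p A^(1/2)` for bounded operators on a complex Hilbert
space. The powers are real powers in the continuous functional calculus; for positive invertible
`A` and `B` these are the usual ones. -/
noncomputable def naturalPower {H : Type*} [NormedAddCommGroup H] [InnerProductSpace ℂ H]
    [CompleteSpace H] (p : ℝ) (A B : H →L[ℂ] H) : H →L[ℂ] H :=
  A ^ (1 / 2 : ℝ) * (A ^ (-(1 / 2) : ℝ) * B * A ^ (-(1 / 2) : ℝ)) ^ p * A ^ (1 / 2 : ℝ)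

/-- The Tsallis relative operator entropy `T_p(A|B) = (A ♮_p B - A) / p`, for `p ≠ 0` and positive
invertible `A` and `B`. -/
noncomputable def tsallisRelativeEntropy {H : Type*} [NormedAddCommGroup H]
    [InnerProductSpace ℂ H] [CompleteSpace H] (p : ℝ) (A B : H →L[ℂ] H) : H →L[ℂ] H :=
  (1 / p) • (naturalPower p A B - A)

/-! Let `C = A^(-1/2) B A^(-1/2)`. For `t` in its spectrum, the mean value theorem gives `(t^p -
1)/p = c^(p-1) (t - 1)` with `m ≤ 1 ≤ c ≤ t ≤ M`. Monotonicity of `x ↦ x^(p-1)` puts this between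
`M^(p-1) (t - 1)` and `m^(p-1) (t - 1)`, in an order that depends on the sign of `p - 1`. Functional
calculus and conjugation by `A^(1/2)` turn this into bounds for `T_p(A|B)` by multiples of `B - A`.
The `M` bound is used for `(A, B)` and pushed through `Φ`; the `m` bound is used for `(Φ A, Φ B)`.
Both then compare with multiples of the same `Φ (B - A)`, so no operator concavity is needed. -/

/-- The mean value theorem for `t ↦ (t ^ p - 1) / p` on `[1, t]`. -/
theorem Real.exists_rpow_sub_one_eq {p t : ℝ} (hp : p ≠ 0) (ht : 1 ≤ t) :
    ∃ c, 1 ≤ c ∧ c ≤ t ∧ 1 / p * (t ^ p - 1) = c ^ (p - 1) * (t - 1) := by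
  rcases ht.eq_or_lt with rfl | ht
  · exact ⟨1, le_rfl, le_rfl, by simp⟩
  · obtain ⟨c, hc, h⟩ := exists_hasDerivAt_eq_slope (fun x : ℝ ↦ x ^ p) (fun x ↦ p * x ^ (p - 1)) ht
      (fun x hx ↦ (Real.continuousAt_rpow_const x p
        (Or.inl (by linarith [hx.1]))).continuousWithinAt)
      (fun x hx ↦ Real.hasDerivAt_rpow_const (Or.inl (by linarith [hx.1])))
    refine ⟨c, hc.1.le, hc.2.le, ?_⟩
    rw [Real.one_rpow, eq_div_iff (by linarith)] at h
    rw [← h]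
    field_simp

section CStarAlgebra

variable {R : Type*} [CStarAlgebra R]

theorem CFC.smul_sub_one_eq_cfc {C : R} (hC : IsSelfAdjoint C) (k : ℝ) :
    k • (C - 1) = cfc (fun t : ℝ ↦ k * (t - 1)) C := by
  rw [cfc_const_mul k (fun t : ℝ ↦ t - 1) C, cfc_sub _ _ C, cfc_id' ℝ C, cfc_const_one ℝ C]

variable [PartialOrder R] [StarOrderedRing R]

theorem continuousOn_rpow_spectrum {C : R} (hC : 1 ≤ C) (p : ℝ) :
    ContinuousOn (fun t : ℝ ↦ t ^ p) (spectrum ℝ C) := fun t ht ↦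
  (Real.continuousAt_rpow_const t p (Or.inl (zero_lt_one.trans_le
    ((CFC.one_le_iff (R := ℝ) C (.of_nonneg (zero_le_one.trans hC))).1 hC t ht)).ne')
    ).continuousWithinAt

theorem CFC.smul_rpow_sub_one_eq_cfc {C : R} (hC : 1 ≤ C) (k p : ℝ) :
    k • (C ^ p - 1) = cfc (fun t : ℝ ↦ k * (t ^ p - 1)) C := by
  have h0 : 0 ≤ C := zero_le_one.trans hC
  have hcont := continuousOn_rpow_spectrum hC p
  rw [cfc_const_mul k (fun t : ℝ ↦ t ^ p - 1) C (by fun_prop), cfc_sub _ _ C,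
    cfc_const_one ℝ C, CFC.rpow_eq_cfc_real h0]

theorem CFC.smul_sub_one_le_smul_rpow_sub_one {C : R} (hC : 1 ≤ C) {p k l : ℝ}
    (h : ∀ t ∈ spectrum ℝ C, k * (t - 1) ≤ l * (t ^ p - 1)) :
    k • (C - 1) ≤ l • (C ^ p - 1) := by
  have hcont := continuousOn_rpow_spectrum hC p
  rw [CFC.smul_sub_one_eq_cfc (.of_nonneg (zero_le_one.trans hC)), CFC.smul_rpow_sub_one_eq_cfc hC]
  exact cfc_mono h (by fun_prop) (by fun_prop)

theorem CFC.smul_rpow_sub_one_le_smul_sub_one {C : R} (hC : 1 ≤ C) {p k l : ℝ}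
    (h : ∀ t ∈ spectrum ℝ C, l * (t ^ p - 1) ≤ k * (t - 1)) :
    l • (C ^ p - 1) ≤ k • (C - 1) := by
  have hcont := continuousOn_rpow_spectrum hC p
  rw [CFC.smul_sub_one_eq_cfc (.of_nonneg (zero_le_one.trans hC)), CFC.smul_rpow_sub_one_eq_cfc hC]
  exact cfc_mono h (by fun_prop) (by fun_prop)

theorem CFC.rpow_half_mul_rpow_half {A : R} (hA : IsStrictlyPositive A) :
    A ^ (1 / 2 : ℝ) * A ^ (1 / 2 : ℝ) = A := by
  rw [← CFC.rpow_add hA.isUnit]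
  norm_num [CFC.rpow_one A hA.nonneg]

theorem CFC.conj_rpow_half_conj_rpow_neg_half {A : R} (hA : IsStrictlyPositive A) (B : R) :
    A ^ (1 / 2 : ℝ) * (A ^ (-(1 / 2) : ℝ) * B * A ^ (-(1 / 2) : ℝ)) * A ^ (1 / 2 : ℝ) = B := by
  have h₁ := CFC.rpow_mul_rpow_neg (1 / 2) hA
  have h₂ := CFC.rpow_neg_mul_rpow (1 / 2) hA
  calc _ = (A ^ (1 / 2 : ℝ) * A ^ (-(1 / 2) : ℝ)) * B *
        (A ^ (-(1 / 2) : ℝ) * A ^ (1 / 2 : ℝ)) := by simp only [mul_assoc]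
    _ = B := by rw [h₁, h₂, one_mul, mul_one]

/-- Trades the spectral condition for `A ≤ B`, a form that a positive map preserves. -/
theorem CFC.one_le_conj_rpow_neg_half_iff {A : R} (hA : IsStrictlyPositive A) {B : R} :
    1 ≤ A ^ (-(1 / 2) : ℝ) * B * A ^ (-(1 / 2) : ℝ) ↔ A ≤ B := by
  refine ⟨fun h ↦ ?_, fun h ↦ ?_⟩
  · have := conjugate_le_conjugate_of_nonneg h (CFC.rpow_nonneg (a := A) (y := 1 / 2))
    rwa [mul_one, CFC.rpow_half_mul_rpow_half hA, CFC.conj_rpow_half_conj_rpow_neg_half hA] at this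
  · have := conjugate_le_conjugate_of_nonneg h (CFC.rpow_nonneg (a := A) (y := -(1 / 2)))
    rwa [CFC.conjugate_rpow_neg_one_half A hA] at this

/-- A bound `r • 1 ≤ A` with `r > 0` survives a unital positive map. -/
theorem PositiveLinearMap.isStrictlyPositive_map (Φ : R →ₚ[ℂ] R) (hΦ : Φ 1 = 1) {A : R}
    (hA : IsStrictlyPositive A) : IsStrictlyPositive (Φ A) := by
  nontriviality R
  obtain ⟨r, hr, hrA⟩ :=
    (CFC.exists_pos_algebraMap_le_iff hA.isSelfAdjoint).2 fun x hx ↦ hA.spectrum_pos hx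
  have h : algebraMap ℝ R r ≤ Φ A := by
    have := OrderHomClass.mono Φ hrA
    rwa [Algebra.algebraMap_eq_smul_one, Φ.map_smul_of_tower, hΦ,
      ← Algebra.algebraMap_eq_smul_one] at this
  exact (isStrictlyPositive_algebraMap hr).of_le h

end CStarAlgebra

section HilbertSpace

variable {H : Type*} [NormedAddCommGroup H] [InnerProductSpace ℂ H] [CompleteSpace H]

theorem tsallisRelativeEntropy_eq_conj {A : H →L[ℂ] H} (hA : IsStrictlyPositive A) (p : ℝ)
    (B : H →L[ℂ] H) :
    tsallisRelativeEntropy p A B = A ^ (1 / 2 : ℝ) *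
      ((1 / p) • ((A ^ (-(1 / 2) : ℝ) * B * A ^ (-(1 / 2) : ℝ)) ^ p - 1)) * A ^ (1 / 2 : ℝ) := by
  rw [tsallisRelativeEntropy, naturalPower, mul_smul_comm, smul_mul_assoc, mul_sub, sub_mul,
    mul_one, CFC.rpow_half_mul_rpow_half hA]

theorem smul_sub_eq_conj {A : H →L[ℂ] H} (hA : IsStrictlyPositive A) (k : ℝ) (B : H →L[ℂ] H) :
    k • (B - A) = A ^ (1 / 2 : ℝ) *
      (k • (A ^ (-(1 / 2) : ℝ) * B * A ^ (-(1 / 2) : ℝ) - 1)) * A ^ (1 / 2 : ℝ) := by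
  rw [mul_smul_comm, smul_mul_assoc, mul_sub, sub_mul, mul_one, CFC.rpow_half_mul_rpow_half hA,
    CFC.conj_rpow_half_conj_rpow_neg_half hA]

theorem smul_sub_le_tsallisRelativeEntropy {A B : H →L[ℂ] H} (hA : IsStrictlyPositive A)
    (hAB : A ≤ B) {p k : ℝ}
    (h : ∀ t ∈ spectrum ℝ (A ^ (-(1 / 2) : ℝ) * B * A ^ (-(1 / 2) : ℝ)),
      k * (t - 1) ≤ 1 / p * (t ^ p - 1)) :
    k • (B - A) ≤ tsallisRelativeEntropy p A B := by
  rw [tsallisRelativeEntropy_eq_conj hA, smul_sub_eq_conj hA]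
  exact conjugate_le_conjugate_of_nonneg (CFC.smul_sub_one_le_smul_rpow_sub_one
    ((CFC.one_le_conj_rpow_neg_half_iff hA).2 hAB) h) CFC.rpow_nonneg

theorem tsallisRelativeEntropy_le_smul_sub {A B : H →L[ℂ] H} (hA : IsStrictlyPositive A)
    (hAB : A ≤ B) {p k : ℝ}
    (h : ∀ t ∈ spectrum ℝ (A ^ (-(1 / 2) : ℝ) * B * A ^ (-(1 / 2) : ℝ)),
      1 / p * (t ^ p - 1) ≤ k * (t - 1)) :
    tsallisRelativeEntropy p A B ≤ k • (B - A) := by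
  rw [tsallisRelativeEntropy_eq_conj hA, smul_sub_eq_conj hA]
  exact conjugate_le_conjugate_of_nonneg (CFC.smul_rpow_sub_one_le_smul_sub_one
    ((CFC.one_le_conj_rpow_neg_half_iff hA).2 hAB) h) CFC.rpow_nonneg

end HilbertSpace

theorem theorem2p2 {H : Type*} [NormedAddCommGroup H] [InnerProductSpace ℂ H] [CompleteSpace H]
    (A B : H →L[ℂ] H) (hA : IsStrictlyPositive A) (hB : 0 ≤ B) (m M : ℝ) (hm : 0 < m)
    (hm1 : m • (1 : H →L[ℂ] H) ≤ 1)
    (hAB : 1 ≤ A ^ (-(1 / 2) : ℝ) * B * A ^ (-(1 / 2) : ℝ))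
    (hABM : A ^ (-(1 / 2) : ℝ) * B * A ^ (-(1 / 2) : ℝ) ≤ M • (1 : H →L[ℂ] H))
    (Φ : (H →L[ℂ] H) →ₚ[ℂ] (H →L[ℂ] H)) (hΦ : Φ 1 = 1) :
    (∀ p : ℝ, -1 ≤ p → p ≤ 1 → p ≠ 0 →
      tsallisRelativeEntropy p (Φ A) (Φ B) ≤
        Φ (tsallisRelativeEntropy p A B) + (m ^ (p - 1) - M ^ (p - 1)) • Φ (B - A)) ∧
    (∀ p : ℝ, 1 ≤ p → p ≤ 2 →
      Φ (tsallisRelativeEntropy p A B) ≤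
        tsallisRelativeEntropy p (Φ A) (Φ B) + (M ^ (p - 1) - m ^ (p - 1)) • Φ (B - A)) := by
  -- Reading the scalar bound `m ≤ 1` off `m • 1 ≤ 1` requires `1 ≠ 0`.
  rcases subsingleton_or_nontrivial (H →L[ℂ] H) with hH | hH
  · exact ⟨fun _ _ _ _ ↦ (Subsingleton.elim _ _).le, fun _ _ _ ↦ (Subsingleton.elim _ _).le⟩
  have hm1' : m ≤ 1 := by
    rw [← Algebra.algebraMap_eq_smul_one, ← map_one (algebraMap ℝ (H →L[ℂ] H))] at hm1
    exact (algebraMap_le_algebraMap (β := H →L[ℂ] H)).1 hm1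
  have hC : ∀ {X Y : H →L[ℂ] H}, IsStrictlyPositive X → X ≤ Y →
      ∀ t ∈ spectrum ℝ (X ^ (-(1 / 2) : ℝ) * Y * X ^ (-(1 / 2) : ℝ)), 1 ≤ t := by
    intro X Y hX hXY
    have h := (CFC.one_le_conj_rpow_neg_half_iff hX).2 hXY
    exact (CFC.one_le_iff (R := ℝ) _ (.of_nonneg (zero_le_one.trans h))).1 h
  have hCM : ∀ t ∈ spectrum ℝ (A ^ (-(1 / 2) : ℝ) * B * A ^ (-(1 / 2) : ℝ)), t ≤ M := by
    rw [← Algebra.algebraMap_eq_smul_one] at hABM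
    exact (le_algebraMap_iff_spectrum_le (.of_nonneg (zero_le_one.trans hAB))).1 hABM
  have hle : A ≤ B := (CFC.one_le_conj_rpow_neg_half_iff hA).1 hAB
  have hΦA := Φ.isStrictlyPositive_map hΦ hA
  have hΦle : Φ A ≤ Φ B := OrderHomClass.mono Φ hle
  have hmap (k : ℝ) : Φ (k • (B - A)) = k • Φ (B - A) := Φ.map_smul_of_tower k _
  refine ⟨fun p _ hp1 hp ↦ ?_, fun p hp1 _ ↦ ?_⟩
  · have h₁ : M ^ (p - 1) • (B - A) ≤ tsallisRelativeEntropy p A B := by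
      refine smul_sub_le_tsallisRelativeEntropy hA hle fun t ht ↦ ?_
      have ht1 := hC hA hle t ht
      obtain ⟨c, hc1, hct, hc⟩ := Real.exists_rpow_sub_one_eq hp ht1
      rw [hc]
      exact mul_le_mul_of_nonneg_right (Real.rpow_le_rpow_of_nonpos (by linarith)
        (hct.trans (hCM t ht)) (by linarith)) (by linarith)
    -- Only `m ≤ 1 ≤ c` enters here, so no upper spectral bound is needed for the image pair.
    have h₂ : tsallisRelativeEntropy p (Φ A) (Φ B) ≤ m ^ (p - 1) • (Φ B - Φ A) := by
      refine tsallisRelativeEntropy_le_smul_sub hΦA hΦle fun t ht ↦ ?_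
      have ht1 := hC hΦA hΦle t ht
      obtain ⟨c, hc1, hct, hc⟩ := Real.exists_rpow_sub_one_eq hp ht1
      rw [hc]
      exact mul_le_mul_of_nonneg_right (Real.rpow_le_rpow_of_nonpos hm
        (hm1'.trans hc1) (by linarith)) (by linarith)
    have h₃ := OrderHomClass.mono Φ h₁
    rw [hmap] at h₃
    rw [← map_sub] at h₂
    calc _ ≤ m ^ (p - 1) • Φ (B - A) := h₂
      _ = M ^ (p - 1) • Φ (B - A) + (m ^ (p - 1) - M ^ (p - 1)) • Φ (B - A) := by
        rw [← add_smul, add_sub_cancel]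
      _ ≤ _ := by gcongr
  · have hp : p ≠ 0 := by linarith
    -- Now `p - 1 ≥ 0`, so `x ↦ x^(p-1)` increases and both bounds reverse.
    have h₁ : tsallisRelativeEntropy p A B ≤ M ^ (p - 1) • (B - A) := by
      refine tsallisRelativeEntropy_le_smul_sub hA hle fun t ht ↦ ?_
      have ht1 := hC hA hle t ht
      obtain ⟨c, hc1, hct, hc⟩ := Real.exists_rpow_sub_one_eq hp ht1
      rw [hc]
      exact mul_le_mul_of_nonneg_right (Real.rpow_le_rpow (by linarith)
        (hct.trans (hCM t ht)) (by linarith)) (by linarith)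
    have h₂ : m ^ (p - 1) • (Φ B - Φ A) ≤ tsallisRelativeEntropy p (Φ A) (Φ B) := by
      refine smul_sub_le_tsallisRelativeEntropy hΦA hΦle fun t ht ↦ ?_
      have ht1 := hC hΦA hΦle t ht
      obtain ⟨c, hc1, hct, hc⟩ := Real.exists_rpow_sub_one_eq hp ht1
      rw [hc]
      exact mul_le_mul_of_nonneg_right (Real.rpow_le_rpow hm.le
        (hm1'.trans hc1) (by linarith)) (by linarith)
    have h₃ := OrderHomClass.mono Φ h₁
    rw [hmap] at h₃
    rw [← map_sub] at h₂
    calc _ ≤ M ^ (p - 1) • Φ (B - A) := h₃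
      _ = m ^ (p - 1) • Φ (B - A) + (M ^ (p - 1) - m ^ (p - 1)) • Φ (B - A) := by
        rw [← add_smul, add_sub_cancel]
      _ ≤ _ := by gcongr
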